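/- Write $[\,\cdot\,]$ for convex hull and $\mathcal V(\cdot)$ for the vertex set. Let $m>1$, and let $P$ be a neighbourly $2m$-polytope in a $2m$-dimensional real space (every $m$ vertices of $P$ span a proper face) with at least $2m+3$ vertices. A $k$-face $U$ of $P$ is *universal* if $[S,U]$ is a face of $P$ for all $S\subset\mathcal V(P)$ with $|S|\le\lfloor(2m-k-1)/2\rfloor$. Let $x_1,\dots,x_m,y_1,\dots,y_m$ be distinct vertices of $P$ such that $\Phi_1=[x_1,y_1]$, $\Phi_j=[\Phi_{j-1},x_j,y_j]$ $(2\le j\le m)$ form a universal tower, i.e. $\Phi_j$ is a universal $(2j-1)$-face of $P$ for $1\le j\le m$. A point $z\notin\operatorname{aff}F$ is *beyond* a facet $F$ of a polytope if $\operatorname{aff}F$ separates $z$ from the polytope, and *beneath* $F$ otherwise. For a tower $\mathcal T=\{T_1\subset\dots\subset T_r\}$ of faces of a polytope let $\mathscr F_j$ be the set of facets containing $T_j$ for $1\le j\le r$, $\mathscr F_j=\emptyset$ for $j>r$, and $\mathcal C(\mathcal T)=(\mathscr F_1\setminus\mathscr F_2)\cup(\mathscr F_3\setminus\mathscr F_4)\cup\cdots$.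 A point is *exactly beyond* $\mathcal C(\mathcal T)$ if it is beyond every facet in $\mathcal C(\mathcal T)$ and beneath every other facet; a vertex sewn through $\mathcal T$ is such a point. Let $\bar x$ be exactly beyond $\mathcal C(\{\Phi_1,\dots,\Phi_m\})$ with respect to $P$. Let $1\le i\le m$ and let $P/\Phi_i$ be a quotient polytope, i.e. a $(2m-2i)$-polytope in a $(2m-2i)$-dimensional real space together with an isomorphism $G\mapsto G^*$ from the lattice of faces of $P$ containing $\Phi_i$ onto its face lattice; for $v\in\mathcal V(P)\setminus\mathcal V(\Phi_i)$, write $v^*$ for the vertex corresponding to $[\Phi_i,v]$. Let $\bar y^*$ be exactly beyond $\mathcal C(\{\Phi_{i+1}^*,\dots,\Phi_m^*\})$ with respect to $P/\Phi_i$. Let $F^*=[v_1^*,\dots,v_{2m-2i}^*]$ be a facet of $P/\Phi_i$, where $v_1,\dots,v_{2m-2i}\in\mathcal V(P)\setminus\mathcal V(\Phi_i)$, and put $F=[v_1,\dots,v_{2m-2i}]$. Then $[\Phi_i,F]$ is a facet of $P$, and $\bar y^*$ is beneath (respectively beyond) $F^*$ if and only if either 1. $\bar x$ is beneath (respectively beyond)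 $[\Phi_i,F]$ and $i$ is even, or 2. $\bar x$ is beyond (respectively beneath) $[\Phi_i,F]$ and $i$ is odd. -/

import Mathlib

namespace Sewing

section

variable {E E' : Type*} [NormedAddCommGroup E] [NormedSpace ℝ E]
  [NormedAddCommGroup E'] [NormedSpace ℝ E']

/-- `P` is a `d`-polytope, full-dimensional in its ambient `d`-dimensional space `E`. -/
structure IsPolytope (d : ℕ) (P : Set E) : Prop where
  finrank_eq : Module.finrank ℝ E = d
  exists_finset : ∃ s : Finset E, P = convexHull ℝ (s : Set E)
  span_eq_top : affineSpan ℝ P = ⊤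

/-- The vertices of `P`. -/
abbrev vertices (P : Set E) : Set E := P.extremePoints ℝ

/-- Faces of a convex set, including the empty face and `P` itself. -/
def IsFace (P F : Set E) : Prop := IsExtreme ℝ P F ∧ Convex ℝ F

/-- A facet is a maximal proper face. -/
def IsFacet (P F : Set E) : Prop :=
  IsFace P F ∧ F ≠ P ∧ ∀ G, IsFace P G → F ⊆ G → G ≠ P → G = F

/-- Every `k` vertices of `P` are the vertices of a proper face of `P`. -/
def IsKNeighbourly (k : ℕ) (P : Set E) : Prop :=
  ∀ S : Finset E, (S : Set E) ⊆ vertices P → S.card = k →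
    IsFace P (convexHull ℝ (S : Set E)) ∧ convexHull ℝ (S : Set E) ≠ P

/-- A neighbourly `d`-polytope. -/
def IsNeighbourly (d : ℕ) (P : Set E) : Prop :=
  IsPolytope d P ∧ IsKNeighbourly (d / 2) P

/-- `U` is a universal `k`-face of the `d`-polytope `P` (used for `k < d`). -/
structure IsUniversalFace (d k : ℕ) (P U : Set E) : Prop where
  isFace : IsFace P U
  nonempty : U.Nonempty
  dim_eq : Module.finrank ℝ (vectorSpan ℝ U) = k
  universal : ∀ S : Finset E, (S : Set E) ⊆ vertices P → S.card ≤ (d - k - 1) / 2 →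
    IsFace P (convexHull ℝ ((S : Set E) ∪ U))

/-- `Φ_0 = ∅` and `Φ_j = [Φ_{j-1}, x_j, y_j]`. -/
def tower (x y : ℕ → E) : ℕ → Set E
  | 0 => ∅
  | n + 1 => convexHull ℝ (tower x y n ∪ {x (n + 1), y (n + 1)})

/-- The vertices `x_1, …, x_m, y_1, …, y_m` span a universal tower `Φ_1 ⊂ ⋯ ⊂ Φ_m`
in the `2m`-polytope `P`. -/
structure IsUniversalTower (m : ℕ) (P : Set E) (x y : ℕ → E) : Prop where
  x_mem : ∀ j ∈ Set.Icc 1 m, x j ∈ vertices P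
  y_mem : ∀ j ∈ Set.Icc 1 m, y j ∈ vertices P
  x_inj : Set.InjOn x (Set.Icc 1 m)
  y_inj : Set.InjOn y (Set.Icc 1 m)
  x_ne_y : ∀ j ∈ Set.Icc 1 m, ∀ k ∈ Set.Icc 1 m, x j ≠ y k
  universal : ∀ j ∈ Set.Icc 1 m, IsUniversalFace (2 * m) (2 * j - 1) P (tower x y j)

/-- For a chain of faces `T 1, …, T m` of `P`: the set of facets that contain `T j`; it is the set
of all facets if `j = 0`, and empty if `j > m`. -/
def facetsThrough (P : Set E) (m : ℕ) (T : ℕ → Set E) (j : ℕ) : Set (Set E) :=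
  {F | IsFacet P F ∧ j ≤ m ∧ (j = 0 ∨ T j ⊆ F)}

/-- `(F_1 \ F_2) ∪ (F_3 \ F_4) ∪ ⋯`, where `F_j` is the set of facets through `T j`. -/
def towerFacets (P : Set E) (m : ℕ) (T : ℕ → Set E) : Set (Set E) :=
  ⋃ j ∈ {j : ℕ | Odd j}, facetsThrough P m T j \ facetsThrough P m T (j + 1)

/-- The flat `aff F` separates `P` and `z`. -/
def Separates (P F : Set E) (z : E) : Prop :=
  ∀ p ∈ P, (affineSpan ℝ F).WOppSide z p

/-- `z` is beyond the facet `F` of `P`. -/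
def Beyond (P F : Set E) (z : E) : Prop :=
  z ∉ affineSpan ℝ F ∧ Separates P F z

/-- `z` is beneath the facet `F` of `P`. -/
def Beneath (P F : Set E) (z : E) : Prop :=
  z ∉ affineSpan ℝ F ∧ ¬ Separates P F z

/-- `z` is beyond every facet of `P` in `C` and beneath every other facet of `P`. -/
def ExactlyBeyond (P : Set E) (C : Set (Set E)) (z : E) : Prop :=
  ∀ F, IsFacet P F → (F ∈ C → Beyond P F z) ∧ (F ∉ C → Beneath P F z)

/-- The faces of `P` that contain `U`, ordered by inclusion. -/
abbrev FacesAbove (P U : Set E) : Type _ := {G : Set E // IsFace P G ∧ U ⊆ G}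

/-- The faces of `Q`, ordered by inclusion. -/
abbrev Faces (Q : Set E') : Type _ := {G : Set E' // IsFace Q G}

/-- A realization of the quotient polytope `P / U` by a polytope `Q`: an isomorphism from the
lattice of faces of `P` that contain `U` to the face lattice of `Q`. -/
abbrev QuotientIso (P U : Set E) (Q : Set E') : Type _ := FacesAbove P U ≃o Faces Q

/-- The face `G*` of `Q = P / U` that corresponds to the face `G ⊇ U` of `P`
(and the empty set if `G` is not such a face). -/
def starFace {P U : Set E} {Q : Set E'} (e : QuotientIso P U Q) (G : Set E) : Set E' :=
  {z | ∃ h : IsFace P G ∧ U ⊆ G, z ∈ (e ⟨G, h⟩ : Set E')}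

end

end Sewing

open Sewing

/-!
Facets of `P / Φ_i` correspond to facets of `P` through `Φ_i`. Membership of a facet in `C(T)`
depends only on the parity of the number of members of the tower that it contains. Passing to
`P / Φ_i` removes the first `i` members, all of which lie in every facet through `Φ_i`, so this
number drops by exactly `i`, and its parity is kept or reversed according as `i` is even or odd.

That the facet of `P` over `[v_1*, …, v_n*]` is `[Φ_i, v_1, …, v_n]` is where universality enters:
since `[Φ_i, w]` is a face for each vertex `w`, a vertex `w ∉ Φ_i` of that facet gives a nonempty
face `[Φ_i, w]*` of `[v_1*, …, v_n*]`, which must contain some `v_j*`. Hence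
`[Φ_i, v_j] ⊆ [Φ_i, w]`, and a face inside `[Φ_i, w]` but not inside `Φ_i` contains `w`.
-/

namespace Sewing

section Convexity

variable {E : Type*} [NormedAddCommGroup E] [NormedSpace ℝ E]

theorem subset_convexHull_inter_of_isExtreme {s A : Set E}
    (hA : IsExtreme ℝ (convexHull ℝ s) A) : A ⊆ convexHull ℝ (s ∩ A) := by
  have hsdiff : convexHull ℝ (s \ A) ⊆ convexHull ℝ s \ A :=
    convexHull_min (Set.sdiff_subset_sdiff_left (subset_convexHull ℝ s))
      (hA.convex_sdiff (convex_convexHull ℝ s))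
  intro z hz
  have hzs : z ∈ convexHull ℝ (s ∩ A ∪ s \ A) := by
    rw [Set.inter_union_sdiff]
    exact hA.1 hz
  rcases (s ∩ A).eq_empty_or_nonempty with h | hin
  · rw [h, Set.empty_union] at hzs
    exact absurd hz (hsdiff hzs).2
  rcases (s \ A).eq_empty_or_nonempty with h | hout
  · rwa [h, Set.union_empty] at hzs
  rw [convexHull_union hin hout, mem_convexJoin] at hzs
  obtain ⟨a, ha, b, hb, hab⟩ := hzs
  rw [← insert_endpoints_openSegment] at hab
  rcases hab with rfl | rfl | hab
  · exact ha
  · exact absurd hz (hsdiff hb).2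
  · have has : a ∈ convexHull ℝ s := convexHull_mono Set.inter_subset_left ha
    exact absurd (hA.right_mem_of_mem_openSegment has (hsdiff hb).1 hz hab) (hsdiff hb).2

theorem mem_of_isExtreme_convexHull_union_singleton {U A : Set E} {w : E} (hU : Convex ℝ U)
    (hA : IsExtreme ℝ (convexHull ℝ (U ∪ {w})) A) (hAU : ¬A ⊆ U) : w ∈ A := by
  by_contra hw
  refine hAU ((subset_convexHull_inter_of_isExtreme hA).trans (convexHull_min ?_ hU))
  rintro z ⟨hz | rfl, hzA⟩
  · exact hz
  · exact absurd hzA hw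

theorem isFace_self {P : Set E} (hP : Convex ℝ P) : IsFace P P :=
  ⟨IsExtreme.refl ℝ P, hP⟩

theorem isFace_empty (P : Set E) : IsFace P ∅ :=
  ⟨⟨Set.empty_subset P, fun _ _ _ _ _ h => h.elim⟩, convex_empty⟩

theorem IsPolytope.convex {d : ℕ} {P : Set E} (hP : IsPolytope d P) : Convex ℝ P := by
  obtain ⟨s, rfl⟩ := hP.exists_finset
  exact convex_convexHull ℝ _

theorem IsPolytope.convexHull_vertices {d : ℕ} {P : Set E} (hP : IsPolytope d P) :
    convexHull ℝ (vertices P) = P := by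
  obtain ⟨s, rfl⟩ := hP.exists_finset
  have hfin : (vertices (convexHull ℝ (s : Set E))).Finite :=
    s.finite_toSet.subset extremePoints_convexHull_subset
  rw [← (hfin.isClosed_convexHull (𝕜 := ℝ)).closure_eq]
  exact closure_convexHull_extremePoints (s.finite_toSet.isCompact_convexHull (𝕜 := ℝ))
    (convex_convexHull ℝ _)

theorem ExactlyBeyond.beyond_iff {P F : Set E} {C : Set (Set E)} {z : E}
    (h : ExactlyBeyond P C z) (hF : IsFacet P F) : Beyond P F z ↔ F ∈ C :=
  ⟨fun hb => by_contra fun hC => ((h F hF).2 hC).2 hb.2, (h F hF).1⟩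

theorem ExactlyBeyond.beneath_iff {P F : Set E} {C : Set (Set E)} {z : E}
    (h : ExactlyBeyond P C z) (hF : IsFacet P F) : Beneath P F z ↔ F ∉ C :=
  ⟨fun hb hC => hb.2 ((h F hF).1 hC).2, (h F hF).2⟩

end Convexity

section Quotient

variable {E E' : Type*} [NormedAddCommGroup E] [NormedSpace ℝ E]
  [NormedAddCommGroup E'] [NormedSpace ℝ E'] {P U : Set E} {Q Fs : Set E'}

theorem starFace_coe (e : QuotientIso P U Q) (G : FacesAbove P U) :
    starFace e (G : Set E) = (e G : Set E') :=
  Set.ext fun _ => ⟨fun ⟨_, hz⟩ => hz, fun hz => ⟨G.2, hz⟩⟩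

theorem starFace_subset_iff (e : QuotientIso P U Q) (hFs : IsFace Q Fs) {G : Set E}
    (hG : IsFace P G) (hUG : U ⊆ G) :
    starFace e G ⊆ Fs ↔ G ⊆ (e.symm ⟨Fs, hFs⟩ : Set E) := by
  rw [starFace_coe e ⟨G, hG, hUG⟩]
  exact (e.le_symm_apply (x := ⟨G, hG, hUG⟩) (y := ⟨Fs, hFs⟩)).symm

theorem starFace_subset_starFace (e : QuotientIso P U Q) {G H : Set E} (hH : IsFace P H)
    (hGH : G ⊆ H) : starFace e G ⊆ starFace e H := by
  rintro z ⟨hG, hz⟩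
  have hle : (⟨G, hG⟩ : FacesAbove P U) ≤ ⟨H, hH, hG.2.trans hGH⟩ := hGH
  exact ⟨⟨hH, hG.2.trans hGH⟩, e.monotone hle hz⟩

theorem QuotientIso.apply_nonempty_iff (e : QuotientIso P U Q) (hU : IsFace P U)
    (G : FacesAbove P U) : (e G : Set E').Nonempty ↔ ¬(G : Set E) ⊆ U := by
  have hbot : e ⟨U, hU, subset_rfl⟩ ≤ ⟨∅, isFace_empty Q⟩ :=
    e.le_symm_apply.1 (e.symm ⟨∅, isFace_empty Q⟩).2.2
  rw [← not_iff_not, Set.not_nonempty_iff_eq_empty, not_not, ← Set.subset_empty_iff]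
  calc (e G : Set E') ⊆ ∅ ↔ e G ≤ e ⟨U, hU, subset_rfl⟩ :=
        ⟨fun h => h.trans (Set.empty_subset _), fun h => h.trans hbot⟩
    _ ↔ (G : Set E) ⊆ U := e.le_iff_le

theorem QuotientIso.symm_eq_iff (e : QuotientIso P U Q) (hP : Convex ℝ P) (hQ : Convex ℝ Q)
    (hU : U ⊆ P) (A : Faces Q) : (e.symm A : Set E) = P ↔ (A : Set E') = Q := by
  let topP : FacesAbove P U := ⟨P, isFace_self hP, hU⟩
  let topQ : Faces Q := ⟨Q, isFace_self hQ⟩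
  have htop : e.symm topQ = topP :=
    le_antisymm (e.symm topQ).2.1.1.1 (e.le_symm_apply.2 (e topP).2.1.1)
  calc (e.symm A : Set E) = P ↔ e.symm A = topP := (Subtype.ext_iff (a2 := topP)).symm
    _ ↔ A = topQ := by rw [← htop, e.symm.injective.eq_iff]
    _ ↔ (A : Set E') = Q := Subtype.ext_iff

theorem QuotientIso.isFacet_symm (e : QuotientIso P U Q) (hP : Convex ℝ P) (hQ : Convex ℝ Q)
    (hU : U ⊆ P) (h : IsFacet Q Fs) : IsFacet P (e.symm ⟨Fs, h.1⟩ : Set E) := by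
  refine ⟨(e.symm ⟨Fs, h.1⟩).2.1, fun hG => h.2.1 ((e.symm_eq_iff hP hQ hU _).1 hG),
    fun G hG hle hne => ?_⟩
  obtain ⟨A, hA⟩ := e.symm.surjective ⟨G, hG, (e.symm ⟨Fs, h.1⟩).2.2.trans hle⟩
  obtain rfl : (e.symm A : Set E) = G := congrArg Subtype.val hA
  have hFsA : Fs ⊆ A := e.symm.le_iff_le.1 hle
  have hAFs : A = ⟨Fs, h.1⟩ :=
    Subtype.ext (h.2.2 A A.2 hFsA fun hAQ => hne ((e.symm_eq_iff hP hQ hU A).2 hAQ))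
  rw [hAFs]

variable {ι : Type*} {G : FacesAbove P U} {W : ι → FacesAbove P U} {vs : ι → E'}

theorem QuotientIso.exists_le_of_apply_eq_singleton (e : QuotientIso P U Q) (hU : IsFace P U)
    (hW : ∀ j, (e (W j) : Set E') = {vs j})
    (hG : (e G : Set E') = convexHull ℝ (Set.range vs)) {A : FacesAbove P U} (hAG : A ≤ G)
    (hAU : ¬(A : Set E) ⊆ U) : ∃ j, W j ≤ A := by
  have hext : IsExtreme ℝ (convexHull ℝ (Set.range vs)) (e A : Set E') :=
    hG ▸ (e A).2.1.mono (e G).2.1.1 (e.monotone hAG)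
  have hne : (Set.range vs ∩ (e A : Set E')).Nonempty :=
    convexHull_nonempty_iff.1 <|
      ((e.apply_nonempty_iff hU A).2 hAU).mono (subset_convexHull_inter_of_isExtreme hext)
  obtain ⟨_, ⟨j, rfl⟩, hj⟩ := hne
  refine ⟨j, e.le_iff_le.1 (show (e (W j) : Set E') ⊆ e A from ?_)⟩
  rwa [hW, Set.singleton_subset_iff]

theorem QuotientIso.coe_eq_convexHull_iUnion (e : QuotientIso P U Q)
    (hP : convexHull ℝ (vertices P) = P) (hU : IsFace P U)
    (huniv : Nonempty ι → ∀ w ∈ vertices P, IsFace P (convexHull ℝ (U ∪ {w})))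
    (hW : ∀ j, (e (W j) : Set E') = {vs j})
    (hG : (e G : Set E') = convexHull ℝ (Set.range vs)) :
    (G : Set E) = convexHull ℝ (U ∪ ⋃ j, (W j : Set E)) := by
  apply Set.Subset.antisymm
  · have hGext : IsExtreme ℝ (convexHull ℝ (vertices P)) (G : Set E) := hP.symm ▸ G.2.1.1
    refine (subset_convexHull_inter_of_isExtreme hGext).trans
      (convexHull_min ?_ (convex_convexHull ℝ _))
    rintro w ⟨hw, hwG⟩
    apply subset_convexHull ℝ
    by_cases hwU : w ∈ U
    · exact Or.inl hwU
    obtain ⟨k, -⟩ := e.exists_le_of_apply_eq_singleton hU hW hG le_rfl fun h => hwU (h hwG)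
    let A : FacesAbove P U := ⟨convexHull ℝ (U ∪ {w}), huniv ⟨k⟩ w hw,
      Set.subset_union_left.trans (subset_convexHull ℝ _)⟩
    have hwA : w ∈ (A : Set E) := subset_convexHull ℝ _ (Or.inr rfl)
    have hAG : A ≤ G :=
      convexHull_min (Set.union_subset G.2.2 (Set.singleton_subset_iff.2 hwG)) G.2.1.2
    obtain ⟨j, hjA⟩ := e.exists_le_of_apply_eq_singleton hU hW hG hAG fun h => hwU (h hwA)
    have hWU : ¬(W j : Set E) ⊆ U :=
      (e.apply_nonempty_iff hU _).1 (hW j ▸ Set.singleton_nonempty _)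
    exact Or.inr (Set.mem_iUnion.2 ⟨j,
      mem_of_isExtreme_convexHull_union_singleton hU.2 ((W j).2.1.1.mono A.2.1.1.1 hjA) hWU⟩)
  · refine convexHull_min (Set.union_subset G.2.2 (Set.iUnion_subset fun j => ?_)) G.2.1.2
    refine e.le_iff_le.1 (show (e (W j) : Set E') ⊆ e G from ?_)
    rw [hW, hG, Set.singleton_subset_iff]
    exact subset_convexHull ℝ _ ⟨j, rfl⟩

theorem QuotientIso.symm_convexHull_range (e : QuotientIso P U Q)
    (hP : convexHull ℝ (vertices P) = P) (hU : IsFace P U)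
    (huniv : Nonempty ι → ∀ w ∈ vertices P, IsFace P (convexHull ℝ (U ∪ {w})))
    {v : ι → E} (hvs : ∀ j, starFace e (convexHull ℝ (U ∪ {v j})) = {vs j})
    (hFs : IsFace Q (convexHull ℝ (Set.range vs))) :
    (e.symm ⟨_, hFs⟩ : Set E) = convexHull ℝ (U ∪ Set.range v) := by
  have hmem : ∀ j, vs j ∈ starFace e (convexHull ℝ (U ∪ {v j})) := fun j => (hvs j).ge rfl
  choose hface _ using hmem
  rw [e.coe_eq_convexHull_iUnion hP hU huniv (W := fun j => ⟨_, hface j⟩) (vs := vs)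
    (fun j => by rw [← starFace_coe, hvs]) (by rw [e.apply_symm_apply])]
  apply Set.Subset.antisymm
  · refine convexHull_min (Set.union_subset
      (Set.subset_union_left.trans (subset_convexHull ℝ _)) (Set.iUnion_subset fun j => ?_))
      (convex_convexHull ℝ _)
    exact convexHull_mono
      (Set.union_subset_union_right U (Set.singleton_subset_iff.2 ⟨j, rfl⟩))
  · refine convexHull_mono (Set.union_subset_union_right U ?_)
    rintro _ ⟨j, rfl⟩
    exact Set.mem_iUnion.2 ⟨j, subset_convexHull ℝ _ (Or.inr rfl)⟩

end Quotient

section Tower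

open Classical in
/-- The largest index `j ≤ m` with `T j ⊆ F`, and `0` if there is none. For a tower
`T 1 ⊂ ⋯ ⊂ T m` this is the number of its members that `F` contains; like `facetsThrough`, it never
looks at `T 0`. -/
noncomputable def towerHeight {α : Type*} (m : ℕ) (T : ℕ → Set α) (F : Set α) : ℕ :=
  Nat.findGreatest (fun j => T j ⊆ F) m

theorem le_towerHeight_iff {α : Type*} {m : ℕ} {T : ℕ → Set α} {F : Set α}
    (hT : MonotoneOn T (Set.Iic m)) {j : ℕ} :
    j ≤ towerHeight m T F ↔ j ≤ m ∧ (j = 0 ∨ T j ⊆ F) := by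
  classical
  constructor
  · intro hj
    have hle : towerHeight m T F ≤ m := Nat.findGreatest_le m
    refine ⟨hj.trans hle, j.eq_zero_or_pos.imp_right fun hpos => ?_⟩
    exact (hT (hj.trans hle) hle hj).trans
      (Nat.findGreatest_of_ne_zero (P := fun j => T j ⊆ F) rfl (hpos.trans_le hj).ne')
  · rintro ⟨hjm, rfl | hjF⟩
    · exact Nat.zero_le _
    · exact Nat.le_findGreatest hjm hjF

variable {E E' : Type*} [NormedAddCommGroup E] [NormedSpace ℝ E]
  [NormedAddCommGroup E'] [NormedSpace ℝ E'] {m i : ℕ} {P F : Set E} {Q Fs : Set E'}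
  {T : ℕ → Set E}

theorem tower_mono (x y : ℕ → E) : Monotone (tower x y) :=
  monotone_nat_of_le_succ fun _ => Set.subset_union_left.trans (subset_convexHull ℝ _)

theorem IsUniversalTower.isFace_convexHull_union_singleton {x y : ℕ → E}
    (hT : IsUniversalTower m P x y) (hi : 1 ≤ i) (him : i < m) {w : E} (hw : w ∈ vertices P) :
    IsFace P (convexHull ℝ (tower x y i ∪ {w})) := by
  have h := (hT.universal i ⟨hi, him.le⟩).universal {w} (by simpa using hw)
    (by rw [Finset.card_singleton]; omega)
  rwa [Finset.coe_singleton, Set.union_comm] at h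

theorem mem_towerFacets_iff_odd_towerHeight (hT : MonotoneOn T (Set.Iic m)) (hF : IsFacet P F) :
    F ∈ towerFacets P m T ↔ Odd (towerHeight m T F) := by
  simp only [towerFacets, facetsThrough, Set.mem_iUnion, Set.mem_sdiff, Set.mem_ofPred_eq, hF,
    true_and, ← le_towerHeight_iff hT]
  refine ⟨fun ⟨j, hj, hle, hlt⟩ => ?_, fun h => ⟨_, h, le_rfl, by omega⟩⟩
  rwa [show towerHeight m T F = j by omega]

theorem monotoneOn_starFace (hT : Monotone T) (hface : ∀ j ∈ Set.Icc i m, IsFace P (T j))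
    (him : i ≤ m) (e : QuotientIso P (T i) Q) :
    MonotoneOn (fun n => starFace e (T (i + n))) (Set.Iic (m - i)) :=
  fun _ _ n (hn : n ≤ m - i) hle => starFace_subset_starFace e
    (hface (i + n) ⟨Nat.le_add_right i n, by omega⟩) (hT (Nat.add_le_add_left hle i))

theorem towerHeight_starFace (hT : Monotone T) (hface : ∀ j ∈ Set.Icc i m, IsFace P (T j))
    (him : i ≤ m) (e : QuotientIso P (T i) Q) (hFs : IsFace Q Fs) :
    towerHeight (m - i) (fun n => starFace e (T (i + n))) Fs =
      towerHeight m T (e.symm ⟨Fs, hFs⟩ : Set E) - i := by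
  set G : Set E := (e.symm ⟨Fs, hFs⟩).1
  have hiG : i ≤ towerHeight m T G :=
    (le_towerHeight_iff (hT.monotoneOn _)).2 ⟨him, Or.inr (e.symm ⟨Fs, hFs⟩).2.2⟩
  have hstar : ∀ n ≤ m - i, (starFace e (T (i + n)) ⊆ Fs ↔ T (i + n) ⊆ G) := fun n hn =>
    starFace_subset_iff e hFs (hface _ ⟨Nat.le_add_right i n, by omega⟩)
      (hT (Nat.le_add_right i n))
  refine eq_of_forall_le_iff fun n => ?_
  rcases n.eq_zero_or_pos with rfl | hn
  · simp only [Nat.zero_le]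
  calc n ≤ towerHeight (m - i) (fun n => starFace e (T (i + n))) Fs
      ↔ n ≤ m - i ∧ T (i + n) ⊆ G := by
        rw [le_towerHeight_iff (monotoneOn_starFace hT hface him e), or_iff_right hn.ne']
        exact and_congr_right (hstar n)
    _ ↔ i + n ≤ towerHeight m T G := by
        rw [le_towerHeight_iff (hT.monotoneOn _), or_iff_right (by omega)]
        exact and_congr_left' (by omega)
    _ ↔ n ≤ towerHeight m T G - i := by omega

theorem mem_towerFacets_starFace_iff (hT : Monotone T)
    (hface : ∀ j ∈ Set.Icc i m, IsFace P (T j)) (him : i ≤ m) (e : QuotientIso P (T i) Q)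
    (hFs : IsFacet Q Fs) (hG : IsFacet P (e.symm ⟨Fs, hFs.1⟩ : Set E)) :
    Fs ∈ towerFacets Q (m - i) (fun n => starFace e (T (i + n))) ↔
      ((e.symm ⟨Fs, hFs.1⟩ : Set E) ∈ towerFacets P m T ↔ Even i) := by
  have hiG : i ≤ towerHeight m T (e.symm ⟨Fs, hFs.1⟩ : Set E) :=
    (le_towerHeight_iff (hT.monotoneOn _)).2 ⟨him, Or.inr (e.symm ⟨Fs, hFs.1⟩).2.2⟩
  rw [mem_towerFacets_iff_odd_towerHeight (monotoneOn_starFace hT hface him e) hFs,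
    mem_towerFacets_iff_odd_towerHeight (hT.monotoneOn _) hG,
    towerHeight_starFace hT hface him e hFs.1, Nat.odd_sub hiG]

end Tower

end Sewing

/-- The empty family `v` occurs at the top of a universal tower: `P / Φ_m` is a point, its facet is
`∅`, and `[Φ_m, w]` need not be a face of `P`. -/
theorem proposition3p2_general {E E' ι : Type*} [NormedAddCommGroup E] [NormedSpace ℝ E]
    [NormedAddCommGroup E'] [NormedSpace ℝ E'] {P : Set E} (hP : convexHull ℝ (vertices P) = P)
    {Q : Set E'} (hQ : Convex ℝ Q) {m i : ℕ} (him : i ≤ m) {T : ℕ → Set E} (hT : Monotone T)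
    (hface : ∀ j ∈ Set.Icc i m, IsFace P (T j)) (e : QuotientIso P (T i) Q)
    (huniv : Nonempty ι → ∀ w ∈ vertices P, IsFace P (convexHull ℝ (T i ∪ {w})))
    {v : ι → E} {vs : ι → E'} (hvs : ∀ j, starFace e (convexHull ℝ (T i ∪ {v j})) = {vs j})
    (hfacet : IsFacet Q (convexHull ℝ (Set.range vs)))
    {xbar : E} (hxbar : ExactlyBeyond P (towerFacets P m T) xbar) {ybar : E'}
    (hybar : ExactlyBeyond Q (towerFacets Q (m - i) fun n => starFace e (T (i + n))) ybar) :
    IsFacet P (convexHull ℝ (T i ∪ Set.range v)) ∧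
    (Beneath Q (convexHull ℝ (Set.range vs)) ybar ↔
      (Beneath P (convexHull ℝ (T i ∪ Set.range v)) xbar ∧ Even i) ∨
      (Beyond P (convexHull ℝ (T i ∪ Set.range v)) xbar ∧ Odd i)) ∧
    (Beyond Q (convexHull ℝ (Set.range vs)) ybar ↔
      (Beyond P (convexHull ℝ (T i ∪ Set.range v)) xbar ∧ Even i) ∨
      (Beneath P (convexHull ℝ (T i ∪ Set.range v)) xbar ∧ Odd i)) := by
  have hU : IsFace P (T i) := hface i ⟨le_rfl, him⟩
  have hG := e.symm_convexHull_range hP hU huniv hvs hfacet.1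
  have hGfacet := e.isFacet_symm (hP ▸ convex_convexHull ℝ _) hQ hU.1.1 hfacet
  have hmem := mem_towerFacets_starFace_iff hT hface him e hfacet hGfacet
  rw [hG] at hGfacet hmem
  rw [hybar.beneath_iff hfacet, hybar.beyond_iff hfacet, hxbar.beneath_iff hGfacet,
    hxbar.beyond_iff hGfacet, hmem, ← Nat.not_even_iff_odd]
  exact ⟨hGfacet, by tauto, by tauto⟩

theorem proposition3p2 {E E' : Type*}
    [NormedAddCommGroup E] [NormedSpace ℝ E] [FiniteDimensional ℝ E]
    [NormedAddCommGroup E'] [NormedSpace ℝ E'] [FiniteDimensional ℝ E']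
    -- the neighbourly `2m`-polytope `P`, the universal tower, and the point sewn onto `P`
    (m : ℕ) (hm : 1 < m) (P : Set E) (hP : IsNeighbourly (2 * m) P)
    (hcard : 2 * m + 3 ≤ (vertices P).ncard)
    (x y : ℕ → E) (hT : IsUniversalTower m P x y)
    (xbar : E) (hxbar : ExactlyBeyond P (towerFacets P m (tower x y)) xbar)
    -- the quotient polytope `Q = P / Φ_i`
    (i : ℕ) (hi : 1 ≤ i) (him : i ≤ m)
    (Q : Set E') (hQ : IsPolytope (2 * m - 2 * i) Q) (e : QuotientIso P (tower x y i) Q)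
    -- the point sewn onto `Q` through the tower `Φ_{i+1}*, …, Φ_m*`
    (ybar : E')
    (hybar : ExactlyBeyond Q
      (towerFacets Q (m - i) (fun n => starFace e (tower x y (i + n)))) ybar)
    -- the facet `F* = [v_1*, …, v_{2m-2i}*]` of `Q`
    (v : Fin (2 * m - 2 * i) → E) (hv : ∀ j, v j ∈ vertices P \ tower x y i)
    (vs : Fin (2 * m - 2 * i) → E')
    (hvs : ∀ j, starFace e (convexHull ℝ (tower x y i ∪ {v j})) = {vs j})
    (F : Set E) (hF : F = convexHull ℝ (Set.range v))
    (Fs : Set E') (hFs : Fs = convexHull ℝ (Set.range vs)) (hfacet : IsFacet Q Fs) :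
    IsFacet P (convexHull ℝ (tower x y i ∪ F)) ∧
    (Beneath Q Fs ybar ↔
      (Beneath P (convexHull ℝ (tower x y i ∪ F)) xbar ∧ Even i) ∨
      (Beyond P (convexHull ℝ (tower x y i ∪ F)) xbar ∧ Odd i)) ∧
    (Beyond Q Fs ybar ↔
      (Beyond P (convexHull ℝ (tower x y i ∪ F)) xbar ∧ Even i) ∨
      (Beneath P (convexHull ℝ (tower x y i ∪ F)) xbar ∧ Odd i)) := by
  subst hF hFs
  rw [convexHull_convexHull_union_right]
  exact proposition3p2_general hP.1.convexHull_vertices hQ.convex him (tower_mono x y)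
    (fun j hj => (hT.universal j ⟨hi.trans hj.1, hj.2⟩).isFace) e
    (fun ⟨j⟩ _ hw => hT.isFace_convexHull_union_singleton hi (by have := j.2; omega) hw)
    hvs hfacet hxbar hybar
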